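/- Let $m\ge 0$, let $n_1,\dots,n_m\ge 1$ be integers, and for $1\le k\le m$, $0\le \ell\le m$ let $A_{k\ell}\in\mathbb C^{n_k\times n_k}$ be Hermitian matrices. For $\lambda=(\lambda_1,\dots,\lambda_m)\in\mathbb R^m$ put $M_k(\lambda)=A_{k0}+\sum_{\ell=1}^m\lambda_\ell A_{k\ell}$. Let $\mathbf i=(i_1,\dots,i_m)$ with $1\le i_k\le n_k$, let $\varepsilon_{k,i_k}(\lambda)$ be the $i_k$-th largest eigenvalue of $M_k(\lambda)$, counted with multiplicity, and define $$F_{\mathbf i}\colon\mathbb R^m\to\mathbb R^m,\qquad F_{\mathbf i}(\lambda)=(\varepsilon_{1,i_1}(\lambda),\dots,\varepsilon_{m,i_m}(\lambda)).$$ For $\lambda\in\mathbb R^m$ let $E(\lambda)$ be the set of tuples $u=(u_1,\dots,u_m)$ such that each $u_k\in\mathbb C^{n_k}$ is a Euclidean unit vector with $M_k(\lambda)u_k=\varepsilon_{k,i_k}(\lambda)u_k$, and for such $u$ let $J(u)=\bigl[u_k^{\mathsf H}A_{k\ell}u_k\bigr]_{k,\ell=1}^m\in\mathbb R^{m\times m}$.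 For a Lipschitz continuous function $\Phi\colon\mathbb R^m\to\mathbb R^m$, Clarke's generalized Jacobian $\partial\Phi(\lambda)$ is the convex hull of all matrices $J$ for which there is a sequence $\lambda^{(j)}\to\lambda$ of points at which $\Phi$ is differentiable with $\Phi'(\lambda^{(j)})\to J$. Then: 1. $F_{\mathbf i}$ is Lipschitz continuous (so that $\partial F_{\mathbf i}$ is defined). 2. If, for every $k$, the multiplicity of the eigenvalue $\varepsilon_{k,i_k}(\cdot)$ of $M_k(\cdot)$ is constant in a neighborhood of $\lambda$, then $F_{\mathbf i}$ is differentiable at $\lambda$, and its Jacobian is $F_{\mathbf i}'(\lambda)=J(u)$ for every $u\in E(\lambda)$. 3. For every $\lambda\in\mathbb R^m$ (in particular where the condition in 2 fails), $\partial F_{\mathbf i}(\lambda)\subseteq\operatorname{conv}\{J(u): u\in E(\lambda)\}$. -/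

import Mathlib

open Filter Topology
open scoped Matrix

noncomputable section

namespace MEP

/-- The matrix `A_{k0} + ∑_{ℓ=1}^m λ_ℓ A_{kℓ}`, i.e. `∑_{ℓ=0}^m λ_ℓ A_{kℓ}` with `λ_0 = 1`.
The parameter `λ_ℓ` with `1 ≤ ℓ ≤ m` is the coordinate of `x` of index `ℓ - 1 : Fin m`. -/
def pencil {m : ℕ} {n : Fin m → ℕ}
    (A : (k : Fin m) → Fin (m + 1) → Matrix (Fin (n k)) (Fin (n k)) ℂ)
    (k : Fin m) (x : EuclideanSpace ℝ (Fin m)) : Matrix (Fin (n k)) (Fin (n k)) ℂ :=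
  A k 0 + ∑ l : Fin m, (x l : ℂ) • A k l.succ

theorem isHermitian_pencil {m : ℕ} {n : Fin m → ℕ}
    {A : (k : Fin m) → Fin (m + 1) → Matrix (Fin (n k)) (Fin (n k)) ℂ}
    (hA : ∀ k l, (A k l).IsHermitian) (k : Fin m) (x : EuclideanSpace ℝ (Fin m)) :
    (pencil A k x).IsHermitian := by
  unfold pencil Matrix.IsHermitian
  rw [Matrix.conjTranspose_add, Matrix.conjTranspose_sum, (hA k 0).eq]
  congr 1
  refine Finset.sum_congr rfl fun l _ => ?_
  rw [Matrix.conjTranspose_smul, (hA k l.succ).eq]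
  simp

/-- The `i`-th largest eigenvalue of `pencil A k x`, counted with multiplicity; the count starts
at `0`, so that `i = 0` is the largest eigenvalue and `i = n k - 1` the smallest. -/
def eps {m : ℕ} {n : Fin m → ℕ}
    {A : (k : Fin m) → Fin (m + 1) → Matrix (Fin (n k)) (Fin (n k)) ℂ}
    (hA : ∀ k l, (A k l).IsHermitian) (k : Fin m) (i : Fin (n k))
    (x : EuclideanSpace ℝ (Fin m)) : ℝ :=
  (isHermitian_pencil hA k x).eigenvalues₀ (Fin.cast (Fintype.card_fin (n k)).symm i)

/-- The function `F_𝐢 : ℝ^m → ℝ^m` of the multiindex `𝐢`. -/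
def F {m : ℕ} {n : Fin m → ℕ}
    {A : (k : Fin m) → Fin (m + 1) → Matrix (Fin (n k)) (Fin (n k)) ℂ}
    (hA : ∀ k l, (A k l).IsHermitian) (i : (k : Fin m) → Fin (n k))
    (x : EuclideanSpace ℝ (Fin m)) : EuclideanSpace ℝ (Fin m) :=
  WithLp.toLp 2 fun k => eps hA k (i k) x

/-- The multiplicity of `eps hA k i x` as an eigenvalue of `pencil A k x`: the dimension of its
eigenspace. -/
def multiplicity {m : ℕ} {n : Fin m → ℕ}
    {A : (k : Fin m) → Fin (m + 1) → Matrix (Fin (n k)) (Fin (n k)) ℂ}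
    (hA : ∀ k l, (A k l).IsHermitian) (k : Fin m) (i : Fin (n k))
    (x : EuclideanSpace ℝ (Fin m)) : ℕ :=
  Module.finrank ℂ
    (Module.End.eigenspace (Matrix.toLin' (pencil A k x)) ((eps hA k i x : ℝ) : ℂ))

/-- `u = (u_1, …, u_m)` consists of Euclidean unit vectors, `u_k` being an eigenvector of
`pencil A k x` for the eigenvalue `eps hA k (i k) x`. -/
def IsUnitEigenvectors {m : ℕ} {n : Fin m → ℕ}
    {A : (k : Fin m) → Fin (m + 1) → Matrix (Fin (n k)) (Fin (n k)) ℂ}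
    (hA : ∀ k l, (A k l).IsHermitian) (i : (k : Fin m) → Fin (n k))
    (x : EuclideanSpace ℝ (Fin m)) (u : (k : Fin m) → EuclideanSpace ℂ (Fin (n k))) : Prop :=
  ∀ k, ‖u k‖ = 1 ∧
    pencil A k x *ᵥ (u k).ofLp = ((eps hA k (i k) x : ℝ) : ℂ) • (u k).ofLp

/-- The `m × m` matrix with entries `u_kᴴ A_{kℓ} u_k`, `1 ≤ k, ℓ ≤ m`. These numbers are real
when the `A_{kℓ}` are Hermitian, so taking the real part only changes the type. -/
def formMatrix {m : ℕ} {n : Fin m → ℕ}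
    (A : (k : Fin m) → Fin (m + 1) → Matrix (Fin (n k)) (Fin (n k)) ℂ)
    (u : (k : Fin m) → EuclideanSpace ℂ (Fin (n k))) : Matrix (Fin m) (Fin m) ℝ :=
  Matrix.of fun k l => (star (u k).ofLp ⬝ᵥ (A k l.succ *ᵥ (u k).ofLp)).re

end MEP

/-- The Jacobian matrix `Φ'(x)`, meaningful where `Φ` is differentiable. -/
def jacobianMatrix {p q : ℕ} (Φ : EuclideanSpace ℝ (Fin q) → EuclideanSpace ℝ (Fin p))
    (x : EuclideanSpace ℝ (Fin q)) : Matrix (Fin p) (Fin q) ℝ :=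
  Matrix.of fun k l => (fderiv ℝ Φ x (EuclideanSpace.single l 1)) k

/-- Clarke's generalized Jacobian `∂Φ(x)` of a Lipschitz function: the convex hull of all limits
of Jacobian matrices along sequences of points of differentiability that tend to `x`. -/
def clarkeJacobian {p q : ℕ} (Φ : EuclideanSpace ℝ (Fin q) → EuclideanSpace ℝ (Fin p))
    (x : EuclideanSpace ℝ (Fin q)) : Set (Matrix (Fin p) (Fin q) ℝ) :=
  convexHull ℝ {J | ∃ y : ℕ → EuclideanSpace ℝ (Fin q),
    (∀ j, DifferentiableAt ℝ Φ (y j)) ∧ Tendsto y atTop (𝓝 x) ∧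
    Tendsto (fun j => jacobianMatrix Φ (y j)) atTop (𝓝 J)}

end

/-!
A Rayleigh quotient `⟪u, T u⟫` is linear in `T`, and sorted eigenvalues are compared through it.
By dimension counting there is a unit vector `u` that is orthogonal to the first `i - 1`
eigenvectors of `S` and to the eigenvectors of `T` after the `i`-th. It satisfies
`λ_i(T) - λ_i(S) ≤ ⟪u, T u⟫ - ⟪u, S u⟫ ≤ ‖T - S‖`, so eigenvalues are Lipschitz.

For a unit eigenvector `u` of `T x₀` for `λ_i`, the residual `T x u - λ_i(T x) u` is `O(|x - x₀|)`.
If the multiplicity is locally constant, then `λ_i(T x)` keeps a fixed distance from the eigenvalues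
different from it, hence `⟪u, T x u⟫` agrees with `λ_i(T x)` up to the square of the residual. This
identifies the derivative.

Without that assumption, let `T = T (x + h d)` and `S = T x` in the first inequality. As `h ↓ 0`, a
limit of the vectors `u` is an eigenvector of `T x` for `λ_i`, so wherever the eigenvalue is
differentiable, its derivative in direction `d` is at most `⟪u, T'(x) d u⟫` for some such `u`. The
bound survives limits of points, and by separation of a point from a compact convex set it places
limits of derivatives in the convex hull. For systems this is applied row by row; the rows may be
recombined because the convex hull of a product is the product of the convex hulls.
-/

section ConvexHull

theorem convexHull_eq_biUnion_image_stdSimplex {V : Type*} [AddCommGroup V] [Module ℝ V]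
    [FiniteDimensional ℝ V] (s : Set V) :
    convexHull ℝ s = ⋃ k ∈ Finset.range (Module.finrank ℝ V + 2),
      (fun p : (Fin k → ℝ) × (Fin k → V) => ∑ i, p.1 i • p.2 i) ''
        (stdSimplex ℝ (Fin k) ×ˢ Set.univ.pi fun _ => s) := by
  apply Set.Subset.antisymm
  · intro v hv
    obtain ⟨ι, _, z, w, hz, hindep, hw, hw_sum, rfl⟩ := eq_pos_convex_span_of_mem_convexHull hv
    have hcard : Fintype.card ι < Module.finrank ℝ V + 2 := by
      have := hindep.card_le_finrank_succ
      have := (vectorSpan ℝ (Set.range z)).finrank_le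
      omega
    let e := Fintype.equivFin ι
    simp only [Set.mem_iUnion, Finset.mem_range]
    refine ⟨Fintype.card ι, hcard, (w ∘ e.symm, z ∘ e.symm), ⟨⟨fun i => (hw _).le, ?_⟩, ?_⟩, ?_⟩
    · exact (e.symm.sum_comp w).trans hw_sum
    · exact fun i _ => hz ⟨_, rfl⟩
    · exact e.symm.sum_comp fun i => w i • z i
  · simp only [Set.iUnion_subset_iff]
    rintro k - _ ⟨⟨w, z⟩, ⟨hw, hz⟩, rfl⟩
    exact (convex_convexHull ℝ s).sum_mem (fun i _ => hw.1 i) hw.2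
      fun i _ => subset_convexHull ℝ s (hz i trivial)

theorem isCompact_convexHull_of_finiteDimensional {V : Type*} [AddCommGroup V] [Module ℝ V]
    [FiniteDimensional ℝ V] [TopologicalSpace V] [ContinuousAdd V] [ContinuousSMul ℝ V]
    {s : Set V} (hs : IsCompact s) : IsCompact (convexHull ℝ s) := by
  rw [convexHull_eq_biUnion_image_stdSimplex]
  refine Finset.isCompact_biUnion _ fun k _ => IsCompact.image ?_ (by fun_prop)
  exact (isCompact_stdSimplex ℝ _).prod (isCompact_univ_pi fun _ => hs)

variable {X : Type*} [NormedAddCommGroup X] [NormedSpace ℝ X] [FiniteDimensional ℝ X]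

theorem exists_eq_eval_of_strongDual_strongDual (f : StrongDual ℝ (StrongDual ℝ X)) :
    ∃ d : X, ∀ g : StrongDual ℝ X, f g = g d := by
  let F : Module.Dual ℝ (Module.Dual ℝ X) :=
    f.toLinearMap ∘ₗ (LinearMap.toContinuousLinearMap (𝕜 := ℝ) (E := X) (F' := ℝ)).toLinearMap
  obtain ⟨d, hd⟩ := (Module.evalEquiv ℝ X).surjective F
  exact ⟨d, fun g => (LinearMap.congr_fun hd g.toLinearMap).symm⟩

theorem mem_convexHull_strongDual_of_forall_exists_le {s : Set (StrongDual ℝ X)}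
    (hs : IsCompact s) {g : StrongDual ℝ X} (h : ∀ d, ∃ f ∈ s, g d ≤ f d) :
    g ∈ convexHull ℝ s := by
  by_contra hg
  obtain ⟨φ, r, hφ_lt, hr_lt⟩ := geometric_hahn_banach_closed_point (convex_convexHull ℝ s)
    (isCompact_convexHull_of_finiteDimensional hs).isClosed hg
  obtain ⟨d, hd⟩ := exists_eq_eval_of_strongDual_strongDual φ
  obtain ⟨f, hf, hgf⟩ := h d
  have := hφ_lt f (subset_convexHull ℝ s hf)
  rw [hd] at this hr_lt
  linarith

end ConvexHull

section CoalescingValues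

variable {α ι : Type*} [Finite ι] {l : Filter α} {f : α → ι → ℝ} {c : ι → ℝ}

theorem exists_pos_eventually_eq_or_lt_abs_sub (hf : Tendsto f l (𝓝 c)) (i : ι) :
    ∃ δ > 0, ∀ᶠ a in l, ∀ j, c j = c i ∨ δ < |f a j - f a i| := by
  obtain ⟨δ, hδ_lt, hδ⟩ : ∃ δ : ℝ, (∀ j, c j ≠ c i → δ < |c j - c i|) ∧ 0 < δ := by
    refine ((eventually_all.2 fun j => ?_).and self_mem_nhdsWithin :
      ∀ᶠ δ : ℝ in 𝓝[>] 0, _ ∧ δ ∈ Set.Ioi 0).exists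
    refine eventually_imp_distrib_left.2 fun hj => ?_
    exact (eventually_lt_nhds (abs_pos.2 (sub_ne_zero.2 hj))).filter_mono nhdsWithin_le_nhds
  refine ⟨δ, hδ, eventually_all.2 fun j => ?_⟩
  by_cases hj : c j = c i
  · exact Eventually.of_forall fun _ => Or.inl hj
  · have hlim := ((tendsto_pi_nhds.1 hf j).sub (tendsto_pi_nhds.1 hf i)).abs
    exact (hlim.eventually_const_lt (hδ_lt j hj)).mono fun _ => Or.inr

/-- Coordinates that differ in the limit stay apart, so a coincidence set can only shrink, and
counting its elements excludes even that. -/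
theorem exists_pos_eventually_eq_or_le_abs_sub (hf : Tendsto f l (𝓝 c)) (i : ι)
    (hcard : ∀ᶠ a in l, {j | c j = c i}.ncard ≤ {j | f a j = f a i}.ncard) :
    ∃ δ > 0, ∀ᶠ a in l, ∀ j, f a j = f a i ∨ δ ≤ |f a j - f a i| := by
  obtain ⟨δ, hδ, hfar⟩ := exists_pos_eventually_eq_or_lt_abs_sub hf i
  refine ⟨δ, hδ, ?_⟩
  filter_upwards [hfar, hcard] with a hfar hcard j
  have hsub : {j | f a j = f a i} ⊆ {j | c j = c i} := fun j hj =>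
    (hfar j).resolve_right fun hlt => by
      rw [Set.mem_ofPred.1 hj, sub_self, abs_zero] at hlt
      exact hδ.not_gt hlt
  have heq := Set.eq_of_subset_of_ncard_le hsub hcard (Set.toFinite _)
  exact (hfar j).imp (fun hj => heq.ge hj) le_of_lt

end CoalescingValues

theorem exists_ultrafilter_le_tendsto_of_isCompact {α Y : Type*} [TopologicalSpace Y]
    {l : Filter α} [l.NeBot] {s : Set Y} (hs : IsCompact s) {u : α → Y} (hu : ∀ a, u a ∈ s) :
    ∃ U : Ultrafilter α, ↑U ≤ l ∧ ∃ w ∈ s, Tendsto u U (𝓝 w) := by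
  obtain ⟨w, hw, hcluster⟩ :=
    hs.exists_mapClusterPt (f := l) (tendsto_principal.2 (Eventually.of_forall hu))
  obtain ⟨U, hU, hUw⟩ := mapClusterPt_iff_ultrafilter.1 hcluster
  exact ⟨U, hU, w, hw, hUw⟩

section SymmetricOperator

variable {𝕜 E : Type*} [RCLike 𝕜] [NormedAddCommGroup E] [InnerProductSpace 𝕜 E]

/-- The unit vectors in the eigenspace of `T` for `μ`; empty when `μ` is not an eigenvalue. -/
def unitEigenvectors (T : E →L[𝕜] E) (μ : 𝕜) : Set E :=
  {u | ‖u‖ = 1 ∧ T u = μ • u}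

theorem mem_unitEigenvectors_of_tendsto {α : Type*} {l : Filter α} [l.NeBot] {R : α → E →L[𝕜] E}
    {T : E →L[𝕜] E} {ν : α → 𝕜} {μ : 𝕜} {u : α → E} {w : E} (hR : Tendsto R l (𝓝 T))
    (hν : Tendsto ν l (𝓝 μ)) (hu : Tendsto u l (𝓝 w))
    (hmem : ∀ a, u a ∈ unitEigenvectors (R a) (ν a)) : w ∈ unitEigenvectors T μ :=
  ⟨tendsto_nhds_unique hu.norm (tendsto_const_nhds.congr fun a => (hmem a).1.symm),
    tendsto_nhds_unique ((isBoundedBilinearMap_apply.continuous.tendsto (T, w)).comp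
      (hR.prodMk_nhds hu)) ((hν.smul hu).congr fun a => (hmem a).2.symm)⟩

local notation "⟪" x ", " y "⟫" => inner 𝕜 x y

/-- The functional `B ↦ re ⟪u, B u⟫` on operators: for a unit vector `u`, the Rayleigh quotient as
a function of the operator. -/
noncomputable def vectorState [NormedSpace ℝ E] [IsScalarTower ℝ 𝕜 E] (u : E) :
    (E →L[𝕜] E) →L[ℝ] ℝ :=
  RCLike.reCLM ∘L (innerSL 𝕜 u ∘L ContinuousLinearMap.apply 𝕜 E u).restrictScalars ℝ

theorem tendsto_vectorState_apply [NormedSpace ℝ E] [IsScalarTower ℝ 𝕜 E] {α : Type*}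
    {l : Filter α} {R : α → E →L[𝕜] E} {T : E →L[𝕜] E} {u : α → E} {w : E}
    (hR : Tendsto R l (𝓝 T)) (hu : Tendsto u l (𝓝 w)) :
    Tendsto (fun a => vectorState (u a) (R a)) l (𝓝 (vectorState w T)) :=
  (RCLike.continuous_re.tendsto _).comp <| hu.inner <|
    (isBoundedBilinearMap_apply.continuous.tendsto (T, w)).comp (hR.prodMk_nhds hu)

theorem exists_norm_eq_one_forall_inner_eq_zero [FiniteDimensional 𝕜 E] {ι : Type*} [Fintype ι]
    (v : ι → E) (h : Fintype.card ι < Module.finrank 𝕜 E) :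
    ∃ u : E, ‖u‖ = 1 ∧ ∀ j, ⟪v j, u⟫ = 0 := by
  have hne : (Submodule.span 𝕜 (Set.range v))ᗮ ≠ ⊥ := by
    rw [Ne, Submodule.orthogonal_eq_bot_iff]
    intro htop
    have := finrank_range_le_card (R := 𝕜) v
    rw [Set.finrank, htop, finrank_top] at this
    omega
  obtain ⟨w, hw, hw0⟩ := Submodule.exists_mem_ne_zero_of_ne_bot hne
  refine ⟨((‖w‖⁻¹ : ℝ) : 𝕜) • w, ?_, fun j => ?_⟩
  · simp [norm_smul, hw0]
  · rw [inner_smul_right, (Submodule.mem_orthogonal _ _).1 hw _ (Submodule.subset_span ⟨j, rfl⟩),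
      mul_zero]

variable [FiniteDimensional 𝕜 E] {n : ℕ} (hn : Module.finrank 𝕜 E = n)

section SpectralSums

variable {T : E →ₗ[𝕜] E} (hT : T.IsSymmetric)

theorem inner_eigenvectorBasis_apply (j : Fin n) (u : E) :
    ⟪hT.eigenvectorBasis hn j, T u⟫ = hT.eigenvalues hn j * ⟪hT.eigenvectorBasis hn j, u⟫ := by
  rw [← hT, hT.apply_eigenvectorBasis, inner_smul_left, RCLike.conj_ofReal]

theorem re_inner_apply_self_sub_eq_sum (μ : ℝ) (u : E) :
    RCLike.re ⟪u, T u⟫ - μ * ‖u‖ ^ 2 =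
      ∑ j, (hT.eigenvalues hn j - μ) * ‖⟪hT.eigenvectorBasis hn j, u⟫‖ ^ 2 := by
  simp only [sub_mul, Finset.sum_sub_distrib, ← Finset.mul_sum,
    OrthonormalBasis.sum_sq_norm_inner_right]
  rw [← (hT.eigenvectorBasis hn).sum_inner_mul_inner u (T u), map_sum]
  congr 1
  refine Finset.sum_congr rfl fun j _ => ?_
  rw [inner_eigenvectorBasis_apply, mul_left_comm, RCLike.re_ofReal_mul, ← inner_conj_symm u,
    RCLike.conj_mul, ← RCLike.ofReal_pow, RCLike.ofReal_re]

theorem norm_apply_sub_smul_sq_eq_sum (μ : ℝ) (u : E) :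
    ‖T u - (μ : 𝕜) • u‖ ^ 2 =
      ∑ j, (hT.eigenvalues hn j - μ) ^ 2 * ‖⟪hT.eigenvectorBasis hn j, u⟫‖ ^ 2 := by
  rw [← (hT.eigenvectorBasis hn).sum_sq_norm_inner_right]
  refine Finset.sum_congr rfl fun j _ => ?_
  rw [inner_sub_right, inner_smul_right, inner_eigenvectorBasis_apply, ← sub_mul, norm_mul,
    ← RCLike.ofReal_sub, RCLike.norm_ofReal, mul_pow, sq_abs]

/-- An approximate eigenvector has a Rayleigh quotient that is correct to second order. -/
theorem mul_abs_re_inner_sub_le_of_gap {μ δ : ℝ}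
    (hgap : ∀ j, hT.eigenvalues hn j = μ ∨ δ ≤ |hT.eigenvalues hn j - μ|) (u : E) :
    δ * |RCLike.re ⟪u, T u⟫ - μ * ‖u‖ ^ 2| ≤ ‖T u - (μ : 𝕜) • u‖ ^ 2 := by
  set b := hT.eigenvectorBasis hn
  set ev := hT.eigenvalues hn
  have hterm (j : Fin n) : δ * |(ev j - μ) * ‖⟪b j, u⟫‖ ^ 2| ≤ (ev j - μ) ^ 2 * ‖⟪b j, u⟫‖ ^ 2 := by
    have hsq : δ * |ev j - μ| ≤ (ev j - μ) ^ 2 := by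
      rcases hgap j with hj | hj
      · simp [ev, hj]
      · rw [← sq_abs, sq]
        gcongr
    rw [abs_mul, abs_of_nonneg (sq_nonneg ‖⟪b j, u⟫‖), ← mul_assoc]
    gcongr
  rcases le_or_gt δ 0 with hδ | hδ
  · exact (mul_nonpos_of_nonpos_of_nonneg hδ (abs_nonneg _)).trans (sq_nonneg _)
  calc δ * |RCLike.re ⟪u, T u⟫ - μ * ‖u‖ ^ 2|
      ≤ δ * ∑ j, |(ev j - μ) * ‖⟪b j, u⟫‖ ^ 2| := by
        rw [re_inner_apply_self_sub_eq_sum hn hT]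
        gcongr
        exact Finset.abs_sum_le_sum_abs _ _
    _ ≤ ∑ j, (ev j - μ) ^ 2 * ‖⟪b j, u⟫‖ ^ 2 := by
        rw [Finset.mul_sum]
        exact Finset.sum_le_sum fun j _ => hterm j
    _ = ‖T u - (μ : 𝕜) • u‖ ^ 2 := (norm_apply_sub_smul_sq_eq_sum hn hT μ u).symm

variable {i : Fin n} {u : E}

theorem le_re_inner_apply_self (hu : ∀ j > i, ⟪hT.eigenvectorBasis hn j, u⟫ = 0) :
    hT.eigenvalues hn i * ‖u‖ ^ 2 ≤ RCLike.re ⟪u, T u⟫ := by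
  rw [← sub_nonneg, re_inner_apply_self_sub_eq_sum hn hT]
  refine Finset.sum_nonneg fun j _ => ?_
  rcases le_or_gt j i with hji | hij
  · exact mul_nonneg (sub_nonneg.2 (hT.eigenvalues_antitone hn hji)) (sq_nonneg _)
  · simp [hu j hij]

theorem eigenvalues_sub_mul_norm_inner_sq_nonpos
    (hu : ∀ j < i, ⟪hT.eigenvectorBasis hn j, u⟫ = 0) (j : Fin n) :
    (hT.eigenvalues hn j - hT.eigenvalues hn i) * ‖⟪hT.eigenvectorBasis hn j, u⟫‖ ^ 2 ≤ 0 := by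
  rcases lt_or_ge j i with hji | hij
  · simp [hu j hji]
  · exact mul_nonpos_of_nonpos_of_nonneg
      (sub_nonpos.2 (hT.eigenvalues_antitone hn hij)) (sq_nonneg _)

theorem re_inner_apply_self_le (hu : ∀ j < i, ⟪hT.eigenvectorBasis hn j, u⟫ = 0) :
    RCLike.re ⟪u, T u⟫ ≤ hT.eigenvalues hn i * ‖u‖ ^ 2 := by
  rw [← sub_nonpos, re_inner_apply_self_sub_eq_sum hn hT]
  exact Finset.sum_nonpos fun j _ => eigenvalues_sub_mul_norm_inner_sq_nonpos hn hT hu j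

theorem apply_eq_smul_of_le_re_inner_apply_self
    (hu : ∀ j < i, ⟪hT.eigenvectorBasis hn j, u⟫ = 0)
    (hle : hT.eigenvalues hn i * ‖u‖ ^ 2 ≤ RCLike.re ⟪u, T u⟫) :
    T u = (hT.eigenvalues hn i : 𝕜) • u := by
  have hsum := sub_eq_zero.2 ((re_inner_apply_self_le hn hT hu).antisymm hle)
  rw [re_inner_apply_self_sub_eq_sum hn hT, Finset.sum_eq_zero_iff_of_nonpos
    fun j _ => eigenvalues_sub_mul_norm_inner_sq_nonpos hn hT hu j] at hsum
  rw [← sub_eq_zero, ← norm_eq_zero, ← sq_eq_zero_iff, norm_apply_sub_smul_sq_eq_sum hn hT]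
  refine Finset.sum_eq_zero fun j hj => ?_
  rw [sq, mul_assoc, hsum j hj, mul_zero]

end SpectralSums

/-- The two families of orthogonality conditions number `n - 1` in all, so dimension counting
leaves a unit vector that satisfies them both. -/
theorem exists_unit_inner_eq_zero_and_eigenvalues_le {S T : E →ₗ[𝕜] E}
    (hS : S.IsSymmetric) (hT : T.IsSymmetric) (i : Fin n) :
    ∃ u : E, ‖u‖ = 1 ∧ (∀ j < i, ⟪hS.eigenvectorBasis hn j, u⟫ = 0) ∧
      hT.eigenvalues hn i ≤ RCLike.re ⟪u, T u⟫ := by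
  let v : {j : Fin n // j ≠ i} → E := fun j =>
    if j < i then hS.eigenvectorBasis hn j else hT.eigenvectorBasis hn j
  have hcard : Fintype.card {j : Fin n // j ≠ i} < Module.finrank 𝕜 E := by
    rw [hn]
    simpa using Fintype.card_subtype_lt (p := (· ≠ i)) (x := i) (by simp)
  obtain ⟨u, hu, hv⟩ := exists_norm_eq_one_forall_inner_eq_zero v hcard
  refine ⟨u, hu, fun j hj => by simpa [v, hj] using hv ⟨j, hj.ne⟩, ?_⟩
  simpa [hu] using le_re_inner_apply_self hn hT (i := i) (u := u)
    fun j hj => by simpa [v, hj.not_gt] using hv ⟨j, hj.ne'⟩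

section SortedEigenvalues

variable {S T : E →L[𝕜] E} (hS : (S : E →ₗ[𝕜] E).IsSymmetric)
  (hT : (T : E →ₗ[𝕜] E).IsSymmetric)

theorem eigenvalues_sub_le_norm_sub (i : Fin n) :
    hT.eigenvalues hn i - hS.eigenvalues hn i ≤ ‖T - S‖ := by
  obtain ⟨u, hu, hu_orth, hT_le⟩ := exists_unit_inner_eq_zero_and_eigenvalues_le hn hS hT i
  have hS_le := re_inner_apply_self_le hn hS hu_orth
  rw [hu, one_pow, mul_one] at hS_le
  calc hT.eigenvalues hn i - hS.eigenvalues hn i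
      ≤ RCLike.re ⟪u, T u⟫ - RCLike.re ⟪u, S u⟫ := sub_le_sub hT_le hS_le
    _ = RCLike.re ⟪u, (T - S) u⟫ := by simp [inner_sub_right]
    _ ≤ ‖u‖ * ‖(T - S) u‖ := re_inner_le_norm _ _
    _ ≤ ‖T - S‖ := by simpa [hu] using (T - S).le_opNorm u

theorem abs_eigenvalues_sub_le_norm_sub (i : Fin n) :
    |hT.eigenvalues hn i - hS.eigenvalues hn i| ≤ ‖T - S‖ :=
  abs_sub_le_iff.2 ⟨eigenvalues_sub_le_norm_sub hn hS hT i,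
    (eigenvalues_sub_le_norm_sub hn hT hS i).trans_eq (norm_sub_rev _ _)⟩

theorem tendsto_eigenvalues {α : Type*} {l : Filter α} {R : α → E →L[𝕜] E}
    (hR : ∀ a, (R a : E →ₗ[𝕜] E).IsSymmetric) (hlim : Tendsto R l (𝓝 S)) (i : Fin n) :
    Tendsto (fun a => (hR a).eigenvalues hn i) l (𝓝 (hS.eigenvalues hn i)) :=
  tendsto_iff_norm_sub_tendsto_zero.2 <| squeeze_zero (fun _ => norm_nonneg _)
    (fun a => abs_eigenvalues_sub_le_norm_sub hn hS (hR a) i)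
    (tendsto_iff_norm_sub_tendsto_zero.1 hlim)

theorem lipschitzWith_eigenvalues {X : Type*} [PseudoEMetricSpace X] {K : NNReal}
    {R : X → E →L[𝕜] E} (hR : ∀ x, (R x : E →ₗ[𝕜] E).IsSymmetric) (hK : LipschitzWith K R)
    (i : Fin n) : LipschitzWith K fun x => (hR x).eigenvalues hn i := fun x y =>
  le_trans (by
    rw [edist_dist, edist_dist, Real.dist_eq, dist_eq_norm]
    exact ENNReal.ofReal_le_ofReal (abs_eigenvalues_sub_le_norm_sub hn (hR y) (hR x) i)) (hK x y)

theorem eigenvectorBasis_mem_unitEigenvectors (i : Fin n) :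
    hT.eigenvectorBasis hn i ∈ unitEigenvectors T (hT.eigenvalues hn i : 𝕜) :=
  ⟨(hT.eigenvectorBasis hn).norm_eq_one i, hT.apply_eigenvectorBasis hn i⟩

theorem exists_pos_eventually_eigenvalues_gap {α : Type*} {l : Filter α} {R : α → E →L[𝕜] E}
    (hR : ∀ a, (R a : E →ₗ[𝕜] E).IsSymmetric) (hlim : Tendsto R l (𝓝 S)) (i : Fin n)
    (hmult : ∀ᶠ a in l,
      Module.finrank 𝕜 (Module.End.eigenspace (R a : E →ₗ[𝕜] E) ((hR a).eigenvalues hn i : 𝕜)) =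
        Module.finrank 𝕜 (Module.End.eigenspace (S : E →ₗ[𝕜] E) (hS.eigenvalues hn i : 𝕜))) :
    ∃ δ > 0, ∀ᶠ a in l, ∀ j, (hR a).eigenvalues hn j = (hR a).eigenvalues hn i ∨
      δ ≤ |(hR a).eigenvalues hn j - (hR a).eigenvalues hn i| := by
  have ncard_eq {T : E →L[𝕜] E} (hT : (T : E →ₗ[𝕜] E).IsSymmetric) :
      {j | hT.eigenvalues hn j = hT.eigenvalues hn i}.ncard =
        Module.finrank 𝕜 (Module.End.eigenspace (T : E →ₗ[𝕜] E) (hT.eigenvalues hn i : 𝕜)) := by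
    rw [← hT.card_filter_eigenvalues_eq hn, ← Set.ncard_coe_finset]
    simp only [RCLike.ofReal_inj, Finset.coe_filter, Finset.mem_univ, true_and]
  refine exists_pos_eventually_eq_or_le_abs_sub
    (tendsto_pi_nhds.2 fun j => tendsto_eigenvalues hn hS hR hlim j) i (hmult.mono fun a ha => ?_)
  rw [ncard_eq, ncard_eq, ha]

theorem norm_apply_sub_eigenvalues_smul_le {i : Fin n} {u : E}
    (hu : u ∈ unitEigenvectors S (hS.eigenvalues hn i : 𝕜)) :
    ‖T u - (hT.eigenvalues hn i : 𝕜) • u‖ ≤ 2 * ‖T - S‖ := by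
  have hsplit : T u - (hT.eigenvalues hn i : 𝕜) • u =
      (T - S) u - ((hT.eigenvalues hn i - hS.eigenvalues hn i : ℝ) : 𝕜) • u := by
    rw [RCLike.ofReal_sub, sub_smul, sub_apply, hu.2]
    abel
  calc ‖T u - (hT.eigenvalues hn i : 𝕜) • u‖
      ≤ ‖(T - S) u‖ + ‖((hT.eigenvalues hn i - hS.eigenvalues hn i : ℝ) : 𝕜) • u‖ :=
        hsplit ▸ norm_sub_le _ _
    _ ≤ ‖T - S‖ + ‖T - S‖ := by
        refine add_le_add (by simpa [hu.1] using (T - S).le_opNorm u) ?_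
        rw [norm_smul, hu.1, mul_one, RCLike.norm_ofReal]
        exact abs_eigenvalues_sub_le_norm_sub hn hS hT i
    _ = 2 * ‖T - S‖ := (two_mul _).symm

end SortedEigenvalues

theorem isCompact_unitEigenvectors (T : E →L[𝕜] E) (μ : 𝕜) :
    IsCompact (unitEigenvectors T μ) := by
  have : ProperSpace E := FiniteDimensional.proper_rclike 𝕜 E
  refine (isCompact_sphere (0 : E) 1).of_isClosed_subset ?_ fun u hu => by simp [hu.1]
  exact (isClosed_eq continuous_norm continuous_const).inter
    (isClosed_eq T.continuous (continuous_const_smul μ))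

variable [NormedSpace ℝ E] [IsScalarTower ℝ 𝕜 E] {X : Type*} [NormedAddCommGroup X]
  [NormedSpace ℝ X] {T : X → E →L[𝕜] E}
  (hT : ∀ x, (T x : E →ₗ[𝕜] E).IsSymmetric) (i : Fin n)

theorem isBigO_eigenvalues_sub_vectorState {x : X} {T' : X →L[ℝ] E →L[𝕜] E}
    (hT' : HasFDerivAt T T' x) {δ : ℝ} (hδ : 0 < δ)
    (hgap : ∀ᶠ y in 𝓝 x, ∀ j, (hT y).eigenvalues hn j = (hT y).eigenvalues hn i ∨
      δ ≤ |(hT y).eigenvalues hn j - (hT y).eigenvalues hn i|)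
    {u : E} (hu : u ∈ unitEigenvectors (T x) ((hT x).eigenvalues hn i : 𝕜)) :
    (fun y => (hT y).eigenvalues hn i - vectorState u (T y)) =O[𝓝 x] fun y => ‖y - x‖ ^ 2 := by
  have hquad : (fun y => (hT y).eigenvalues hn i - vectorState u (T y)) =O[𝓝 x]
      fun y => ‖T y - T x‖ ^ 2 := by
    refine .of_bound (4 / δ) (hgap.mono fun y hy => ?_)
    have hle := mul_abs_re_inner_sub_le_of_gap hn (hT y) hy u
    rw [hu.1, one_pow, mul_one, abs_sub_comm] at hle
    rw [Real.norm_eq_abs, norm_pow, norm_norm, div_mul_eq_mul_div, le_div_iff₀' hδ]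
    calc δ * |(hT y).eigenvalues hn i - vectorState u (T y)|
        ≤ ‖T y u - ((hT y).eigenvalues hn i : 𝕜) • u‖ ^ 2 := hle
      _ ≤ (2 * ‖T y - T x‖) ^ 2 := by
        gcongr
        exact norm_apply_sub_eigenvalues_smul_le hn (hT x) (hT y) hu
      _ = 4 * ‖T y - T x‖ ^ 2 := by ring
  exact hquad.trans (hT'.isBigO_sub.norm_norm.pow 2)

theorem hasFDerivAt_eigenvalues {x : X} {T' : X →L[ℝ] E →L[𝕜] E} (hT' : HasFDerivAt T T' x)
    (hmult : ∀ᶠ y in 𝓝 x,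
      Module.finrank 𝕜 (Module.End.eigenspace (T y : E →ₗ[𝕜] E) ((hT y).eigenvalues hn i : 𝕜)) =
        Module.finrank 𝕜 (Module.End.eigenspace (T x : E →ₗ[𝕜] E) ((hT x).eigenvalues hn i : 𝕜)))
    {u : E} (hu : u ∈ unitEigenvectors (T x) ((hT x).eigenvalues hn i : 𝕜)) :
    HasFDerivAt (fun y => (hT y).eigenvalues hn i) (vectorState u ∘L T') x := by
  obtain ⟨δ, hδ, hgap⟩ := exists_pos_eventually_eigenvalues_gap hn (hT x) hT
    hT'.continuousAt.tendsto i hmult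
  have hdiff : HasFDerivAt (fun y => (hT y).eigenvalues hn i - vectorState u (T y))
      (0 : X →L[ℝ] ℝ) x :=
    (isBigO_eigenvalues_sub_vectorState hn hT i hT' hδ hgap hu).hasFDerivAt one_lt_two
  simpa using hdiff.fun_add ((vectorState u).hasFDerivAt.comp x hT')

theorem mem_unitEigenvectors_of_tendsto_of_le {α : Type*} {l : Filter α} [l.NeBot]
    {R : α → E →L[𝕜] E} {S : E →L[𝕜] E} (hR : ∀ a, (R a : E →ₗ[𝕜] E).IsSymmetric)
    (hS : (S : E →ₗ[𝕜] E).IsSymmetric) (hlim : Tendsto R l (𝓝 S)) {u : α → E} {w : E}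
    (hu : ∀ a, ‖u a‖ = 1) (hw : Tendsto u l (𝓝 w))
    (hu_orth : ∀ a, ∀ j < i, ⟪hS.eigenvectorBasis hn j, u a⟫ = 0)
    (hu_le : ∀ a, (hR a).eigenvalues hn i ≤ vectorState (u a) (R a)) :
    w ∈ unitEigenvectors S (hS.eigenvalues hn i : 𝕜) := by
  have hw_norm : ‖w‖ = 1 :=
    tendsto_nhds_unique hw.norm (tendsto_const_nhds.congr fun a => (hu a).symm)
  have hw_orth (j : Fin n) (hj : j < i) : ⟪hS.eigenvectorBasis hn j, w⟫ = 0 :=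
    tendsto_nhds_unique (tendsto_const_nhds.inner hw)
      (tendsto_const_nhds.congr fun a => (hu_orth a j hj).symm)
  have hw_le : hS.eigenvalues hn i ≤ vectorState w S :=
    le_of_tendsto_of_tendsto' (tendsto_eigenvalues hn hS hR hlim i)
      (tendsto_vectorState_apply hlim hw) hu_le
  refine ⟨hw_norm, apply_eq_smul_of_le_re_inner_apply_self hn hS hw_orth ?_⟩
  rwa [hw_norm, one_pow, mul_one]

/-- For small `h > 0`, a vector `u` as in `exists_unit_inner_eq_zero_and_eigenvalues_le` for `T x`
and `T (x + h • d)` has a difference quotient of Rayleigh quotients above that of `λ_i`. -/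
theorem exists_mem_unitEigenvectors_le_of_hasLineDerivAt {x d : X} {B : E →L[𝕜] E} {c : ℝ}
    (hB : HasLineDerivAt ℝ T B x d)
    (hc : HasLineDerivAt ℝ (fun y => (hT y).eigenvalues hn i) c x d) :
    ∃ u ∈ unitEigenvectors (T x) ((hT x).eigenvalues hn i : 𝕜), c ≤ vectorState u B := by
  have : ProperSpace E := FiniteDimensional.proper_rclike 𝕜 E
  choose u hu hu_orth hu_le using fun h : ℝ =>
    exists_unit_inner_eq_zero_and_eigenvalues_le hn (hT x) (hT (x + h • d)) i
  obtain ⟨U, hU, w, -, hUw⟩ := exists_ultrafilter_le_tendsto_of_isCompact (l := 𝓝[>] 0)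
    (isCompact_sphere (0 : E) 1) fun h => mem_sphere_zero_iff_norm.2 (hu h)
  have hlim : Tendsto (fun h : ℝ => T (x + h • d)) U (𝓝 (T x)) := by
    have := (HasDerivAt.continuousAt hB).tendsto
    rw [zero_smul, add_zero] at this
    exact this.mono_left (hU.trans nhdsWithin_le_nhds)
  refine ⟨w, mem_unitEigenvectors_of_tendsto_of_le hn i (fun _ => hT _) (hT x) hlim hu hUw
    hu_orth hu_le, ?_⟩
  refine le_of_tendsto_of_tendsto (hc.tendsto_slope_zero_right.mono_left hU)
    (tendsto_vectorState_apply (hB.tendsto_slope_zero_right.mono_left hU) hUw) ?_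
  filter_upwards [hU self_mem_nhdsWithin] with h (hh : 0 < h)
  have hle := re_inner_apply_self_le hn (hT x) (hu_orth h)
  rw [hu, one_pow, mul_one] at hle
  rw [map_smul, smul_eq_mul, smul_eq_mul, map_sub]
  exact mul_le_mul_of_nonneg_left (sub_le_sub (hu_le h) hle) (inv_nonneg.2 hh.le)

theorem exists_mem_unitEigenvectors_le_of_tendsto {T' : X → X →L[ℝ] E →L[𝕜] E}
    (hT' : ∀ y, HasFDerivAt T (T' y) y) {x : X} (hcont : ContinuousAt T' x) {α : Type*}
    {l : Filter α} [l.NeBot] {y : α → X} (hy : Tendsto y l (𝓝 x)) {g : α → StrongDual ℝ X}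
    (hg : ∀ a, HasFDerivAt (fun z => (hT z).eigenvalues hn i) (g a) (y a)) {d : X} {c : ℝ}
    (hlim : Tendsto (fun a => g a d) l (𝓝 c)) :
    ∃ u ∈ unitEigenvectors (T x) ((hT x).eigenvalues hn i : 𝕜), c ≤ vectorState u (T' x d) := by
  have : ProperSpace E := FiniteDimensional.proper_rclike 𝕜 E
  choose u hu hu_le using fun a => exists_mem_unitEigenvectors_le_of_hasLineDerivAt hn hT i
    ((hT' (y a)).hasLineDerivAt d) ((hg a).hasLineDerivAt d)
  obtain ⟨U, hU, w, -, hUw⟩ := exists_ultrafilter_le_tendsto_of_isCompact (l := l)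
    (isCompact_sphere (0 : E) 1) fun a => mem_sphere_zero_iff_norm.2 (hu a).1
  have hTy : Tendsto (fun a => T (y a)) U (𝓝 (T x)) :=
    (hT' x).continuousAt.tendsto.comp (hy.mono_left hU)
  have hev := (RCLike.continuous_ofReal (K := 𝕜)).tendsto _ |>.comp
    (tendsto_eigenvalues hn (hT x) (fun a => hT (y a)) hTy i)
  have hT'y : Tendsto (fun a => T' (y a) d) U (𝓝 (T' x d)) :=
    ((ContinuousLinearMap.apply ℝ (E →L[𝕜] E) d).continuous.tendsto _).comp
      (hcont.tendsto.comp (hy.mono_left hU))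
  exact ⟨w, mem_unitEigenvectors_of_tendsto hTy hev hUw hu,
    le_of_tendsto_of_tendsto' (hlim.mono_left hU) (tendsto_vectorState_apply hT'y hUw) hu_le⟩

theorem mem_convexHull_vectorState_of_tendsto [FiniteDimensional ℝ X]
    {T' : X → X →L[ℝ] E →L[𝕜] E} (hT' : ∀ y, HasFDerivAt T (T' y) y) {x : X}
    (hcont : ContinuousAt T' x) {α : Type*} {l : Filter α} [l.NeBot] {y : α → X}
    (hy : Tendsto y l (𝓝 x)) {g : α → StrongDual ℝ X}
    (hg : ∀ a, HasFDerivAt (fun z => (hT z).eigenvalues hn i) (g a) (y a)) {g₀ : StrongDual ℝ X}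
    (hlim : ∀ d, Tendsto (fun a => g a d) l (𝓝 (g₀ d))) :
    g₀ ∈ convexHull ℝ ((fun u => vectorState u ∘L T' x) ''
      unitEigenvectors (T x) ((hT x).eigenvalues hn i : 𝕜)) := by
  have hcont_state : Continuous fun u : E => vectorState u ∘L T' x :=
    continuous_clm_apply.2 fun d => continuous_iff_continuousAt.2 fun u =>
      tendsto_vectorState_apply tendsto_const_nhds tendsto_id
  refine mem_convexHull_strongDual_of_forall_exists_le
    ((isCompact_unitEigenvectors _ _).image hcont_state) fun d => ?_
  obtain ⟨u, hu, hle⟩ :=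
    exists_mem_unitEigenvectors_le_of_tendsto hn hT i hT' hcont hy hg (hlim d)
  exact ⟨_, ⟨u, hu, rfl⟩, hle⟩

end SymmetricOperator

section Jacobian

variable {p q : ℕ} {Φ : EuclideanSpace ℝ (Fin q) → EuclideanSpace ℝ (Fin p)}
  {x : EuclideanSpace ℝ (Fin q)}

theorem jacobianMatrix_mulVec (Φ : EuclideanSpace ℝ (Fin q) → EuclideanSpace ℝ (Fin p))
    (x d : EuclideanSpace ℝ (Fin q)) : jacobianMatrix Φ x *ᵥ d.ofLp = (fderiv ℝ Φ x d).ofLp := by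
  have hd : d = ∑ l, d l • EuclideanSpace.single l (1 : ℝ) := by
    simpa using ((EuclideanSpace.basisFun (Fin q) ℝ).sum_repr d).symm
  ext k
  conv_rhs => rw [hd, map_sum]
  simp [Matrix.mulVec, dotProduct, jacobianMatrix, mul_comm]

theorem hasFDerivAt_proj_comp_fderiv (hΦ : DifferentiableAt ℝ Φ x) (k : Fin p) :
    HasFDerivAt (fun y => Φ y k) (EuclideanSpace.proj k ∘L fderiv ℝ Φ x) x :=
  (EuclideanSpace.proj k : EuclideanSpace ℝ (Fin p) →L[ℝ] ℝ).hasFDerivAt.comp x hΦ.hasFDerivAt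

theorem jacobianMatrix_apply_of_hasFDerivAt (hΦ : DifferentiableAt ℝ Φ x) {k : Fin p}
    {g : StrongDual ℝ (EuclideanSpace ℝ (Fin q))} (hg : HasFDerivAt (fun y => Φ y k) g x)
    (l : Fin q) : jacobianMatrix Φ x k l = g (EuclideanSpace.single l 1) :=
  DFunLike.congr_fun ((hasFDerivAt_proj_comp_fderiv hΦ k).unique hg) _

end Jacobian

namespace MEP

variable {m : ℕ} {n : Fin m → ℕ}
  {A : (k : Fin m) → Fin (m + 1) → Matrix (Fin (n k)) (Fin (n k)) ℂ}

/-- The linear part `x ↦ ∑ x_ℓ A_{kℓ}` of `pencil A k`, with values in the operators on `ℂ^{n_k}`;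
it is the derivative of the pencil. -/
noncomputable def linearPart (A : (k : Fin m) → Fin (m + 1) → Matrix (Fin (n k)) (Fin (n k)) ℂ)
    (k : Fin m) : EuclideanSpace ℝ (Fin m) →L[ℝ]
      EuclideanSpace ℂ (Fin (n k)) →L[ℂ] EuclideanSpace ℂ (Fin (n k)) :=
  ∑ l : Fin m, (EuclideanSpace.proj l : EuclideanSpace ℝ (Fin m) →L[ℝ] ℝ).smulRight
    (Matrix.toEuclideanCLM (𝕜 := ℂ) (A k l.succ))

theorem linearPart_apply (k : Fin m) (x : EuclideanSpace ℝ (Fin m)) :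
    linearPart A k x = ∑ l, x l • Matrix.toEuclideanCLM (𝕜 := ℂ) (A k l.succ) := by
  simp [linearPart, sum_apply]

theorem linearPart_single (k l : Fin m) :
    linearPart A k (EuclideanSpace.single l 1) = Matrix.toEuclideanCLM (𝕜 := ℂ) (A k l.succ) := by
  rw [linearPart_apply, Finset.sum_eq_single l (fun j _ hj => ?_) (by simp)]
  · simp
  · rw [PiLp.single_apply, if_neg hj]
    exact zero_smul ℝ (Matrix.toEuclideanCLM (𝕜 := ℂ) (A k j.succ))

theorem toEuclideanCLM_pencil (k : Fin m) (x : EuclideanSpace ℝ (Fin m)) :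
    Matrix.toEuclideanCLM (𝕜 := ℂ) (pencil A k x) =
      Matrix.toEuclideanCLM (𝕜 := ℂ) (A k 0) + linearPart A k x := by
  rw [pencil, map_add, map_sum, linearPart_apply]
  exact congrArg _ (Finset.sum_congr rfl fun l _ =>
    map_smul (Matrix.toEuclideanCLM (𝕜 := ℂ)) (x l : ℂ) (A k l.succ))

theorem hasFDerivAt_toEuclideanCLM_pencil (k : Fin m) (x : EuclideanSpace ℝ (Fin m)) :
    HasFDerivAt (fun y => Matrix.toEuclideanCLM (𝕜 := ℂ) (pencil A k y)) (linearPart A k) x := by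
  simp only [toEuclideanCLM_pencil]
  exact (linearPart A k).hasFDerivAt.const_add _

theorem lipschitzWith_toEuclideanCLM_pencil (k : Fin m) :
    LipschitzWith ‖linearPart A k‖₊ fun x => Matrix.toEuclideanCLM (𝕜 := ℂ) (pencil A k x) := by
  simp only [toEuclideanCLM_pencil]
  exact .of_dist_le_mul fun x y => by
    simpa only [dist_add_left] using (linearPart A k).lipschitz.dist_le_mul x y

/-- `eps hA k i x` unfolds to a sorted eigenvalue `LinearMap.IsSymmetric.eigenvalues` of this
operator; the results on symmetric operators apply to it through that definitional equality. -/
theorem isSymmetric_toEuclideanCLM_pencil (hA : ∀ k l, (A k l).IsHermitian) (k : Fin m)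
    (x : EuclideanSpace ℝ (Fin m)) :
    (Matrix.toEuclideanCLM (𝕜 := ℂ) (pencil A k x) :
      EuclideanSpace ℂ (Fin (n k)) →ₗ[ℂ] EuclideanSpace ℂ (Fin (n k))).IsSymmetric :=
  Matrix.isSymmetric_toEuclideanLin_iff.2 (isHermitian_pencil hA k x)

theorem toEuclideanCLM_apply_eq_smul_iff {p : ℕ} (M : Matrix (Fin p) (Fin p) ℂ) (c : ℂ)
    (u : EuclideanSpace ℂ (Fin p)) :
    Matrix.toEuclideanCLM (𝕜 := ℂ) M u = c • u ↔ M *ᵥ u.ofLp = c • u.ofLp := by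
  rw [← (WithLp.ofLp_injective 2).eq_iff]
  rfl

theorem isUnitEigenvectors_iff (hA : ∀ k l, (A k l).IsHermitian) (i : (k : Fin m) → Fin (n k))
    (x : EuclideanSpace ℝ (Fin m)) (u : (k : Fin m) → EuclideanSpace ℂ (Fin (n k))) :
    IsUnitEigenvectors hA i x u ↔ ∀ k, u k ∈ unitEigenvectors
      (Matrix.toEuclideanCLM (𝕜 := ℂ) (pencil A k x)) ((eps hA k (i k) x : ℝ) : ℂ) :=
  forall_congr' fun _ => and_congr_right fun _ => (toEuclideanCLM_apply_eq_smul_iff _ _ _).symm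

theorem exists_isUnitEigenvectors (hA : ∀ k l, (A k l).IsHermitian) (i : (k : Fin m) → Fin (n k))
    (x : EuclideanSpace ℝ (Fin m)) : ∃ u, IsUnitEigenvectors hA i x u :=
  ⟨_, (isUnitEigenvectors_iff hA i x _).2 fun k =>
    eigenvectorBasis_mem_unitEigenvectors _ (isSymmetric_toEuclideanCLM_pencil hA k x) _⟩

theorem multiplicity_eq_finrank (hA : ∀ k l, (A k l).IsHermitian) (k : Fin m) (i : Fin (n k))
    (x : EuclideanSpace ℝ (Fin m)) :
    multiplicity hA k i x = Module.finrank ℂ (Module.End.eigenspace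
      (Matrix.toEuclideanCLM (𝕜 := ℂ) (pencil A k x) :
        EuclideanSpace ℂ (Fin (n k)) →ₗ[ℂ] EuclideanSpace ℂ (Fin (n k)))
      ((eps hA k i x : ℝ) : ℂ)) := by
  refine (LinearEquiv.finrank_eq (LinearEquiv.ofSubmodules (WithLp.linearEquiv 2 ℂ _) _ _ ?_)).symm
  ext v
  rw [Submodule.mem_map_equiv, Module.End.mem_eigenspace_iff, Module.End.mem_eigenspace_iff]
  exact toEuclideanCLM_apply_eq_smul_iff _ _ _

theorem formMatrix_apply (u : (k : Fin m) → EuclideanSpace ℂ (Fin (n k))) (k l : Fin m) :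
    formMatrix A u k l = vectorState (u k) (linearPart A k (EuclideanSpace.single l 1)) := by
  change _ = RCLike.re (inner ℂ (u k) _)
  rw [linearPart_single, EuclideanSpace.inner_eq_star_dotProduct, dotProduct_comm]
  rfl

variable (hA : ∀ k l, (A k l).IsHermitian) (i : (k : Fin m) → Fin (n k))

theorem exists_lipschitzWith_F : ∃ K : NNReal, LipschitzWith K (F hA i) := by
  let K : NNReal := Finset.univ.sup fun k => ‖linearPart A k‖₊
  have hK (k : Fin m) : LipschitzWith K (eps hA k (i k)) :=
    (lipschitzWith_eigenvalues _ (isSymmetric_toEuclideanCLM_pencil hA k)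
      (lipschitzWith_toEuclideanCLM_pencil k) _).weaken
      (Finset.le_sup (f := fun k => ‖linearPart A k‖₊) (Finset.mem_univ k))
  exact ⟨_, (PiLp.lipschitzWith_toLp 2 _).comp fun y z => edist_pi_le_iff.2 fun k => hK k y z⟩

variable {x : EuclideanSpace ℝ (Fin m)}

section ConstantMultiplicity

variable {u : (k : Fin m) → EuclideanSpace ℂ (Fin (n k))}

theorem hasFDerivAt_eps
    (hmult : ∀ k, ∀ᶠ y in 𝓝 x, multiplicity hA k (i k) y = multiplicity hA k (i k) x)
    (hu : IsUnitEigenvectors hA i x u) (k : Fin m) :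
    HasFDerivAt (eps hA k (i k)) (vectorState (u k) ∘L linearPart A k) x := by
  simp only [multiplicity_eq_finrank] at hmult
  exact hasFDerivAt_eigenvalues _ (isSymmetric_toEuclideanCLM_pencil hA k) _
    (hasFDerivAt_toEuclideanCLM_pencil k x) (hmult k) ((isUnitEigenvectors_iff hA i x u).1 hu k)

theorem differentiableAt_F
    (hmult : ∀ k, ∀ᶠ y in 𝓝 x, multiplicity hA k (i k) y = multiplicity hA k (i k) x) :
    DifferentiableAt ℝ (F hA i) x := by
  obtain ⟨u, hu⟩ := exists_isUnitEigenvectors hA i x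
  exact differentiableAt_euclidean.2 fun k => (hasFDerivAt_eps hA i hmult hu k).differentiableAt

theorem jacobianMatrix_F_eq_formMatrix
    (hmult : ∀ k, ∀ᶠ y in 𝓝 x, multiplicity hA k (i k) y = multiplicity hA k (i k) x)
    (hu : IsUnitEigenvectors hA i x u) : jacobianMatrix (F hA i) x = formMatrix A u := by
  ext k l
  rw [formMatrix_apply, jacobianMatrix_apply_of_hasFDerivAt (differentiableAt_F hA i hmult)
    (hasFDerivAt_eps hA i hmult hu k)]
  rfl

end ConstantMultiplicity

theorem row_mem_convexHull {y : ℕ → EuclideanSpace ℝ (Fin m)} {J : Matrix (Fin m) (Fin m) ℝ}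
    (hdiff : ∀ j, DifferentiableAt ℝ (F hA i) (y j)) (hy : Tendsto y atTop (𝓝 x))
    (hJ : Tendsto (fun j => jacobianMatrix (F hA i) (y j)) atTop (𝓝 J)) (k : Fin m) :
    J k ∈ convexHull ℝ ((fun v l => vectorState v (linearPart A k (EuclideanSpace.single l 1))) ''
      unitEigenvectors (Matrix.toEuclideanCLM (𝕜 := ℂ) (pencil A k x))
        ((eps hA k (i k) x : ℝ) : ℂ)) := by
  let J' : StrongDual ℝ (EuclideanSpace ℝ (Fin m)) :=
    EuclideanSpace.proj k ∘L Matrix.toEuclideanCLM (𝕜 := ℝ) J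
  let coords : StrongDual ℝ (EuclideanSpace ℝ (Fin m)) →ₗ[ℝ] Fin m → ℝ :=
    LinearMap.pi fun l => (ContinuousLinearMap.apply ℝ ℝ (EuclideanSpace.single l 1)).toLinearMap
  have hlim (d : EuclideanSpace ℝ (Fin m)) :
      Tendsto (fun j => (EuclideanSpace.proj k ∘L fderiv ℝ (F hA i) (y j)) d) atTop
        (𝓝 (J' d)) := by
    have hmulVec : Tendsto (fun j => jacobianMatrix (F hA i) (y j) *ᵥ d.ofLp) atTop
        (𝓝 (J *ᵥ d.ofLp)) :=
      ((continuous_id.matrix_mulVec continuous_const).tendsto J).comp hJ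
    simpa [J', jacobianMatrix_mulVec] using tendsto_pi_nhds.1 hmulVec k
  have hmem : J' ∈ convexHull ℝ ((fun v => vectorState v ∘L linearPart A k) '' unitEigenvectors
      (Matrix.toEuclideanCLM (𝕜 := ℂ) (pencil A k x)) ((eps hA k (i k) x : ℝ) : ℂ)) :=
    mem_convexHull_vectorState_of_tendsto _ (isSymmetric_toEuclideanCLM_pencil hA k) _
      (hasFDerivAt_toEuclideanCLM_pencil k) continuousAt_const hy
      (fun j => hasFDerivAt_proj_comp_fderiv (hdiff j) k) hlim
  have hJ' : coords J' = J k := by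
    ext l
    simp [coords, J']
  have hcoords := Set.mem_image_of_mem coords hmem
  rw [coords.image_convexHull, Set.image_image, hJ'] at hcoords
  exact hcoords

theorem clarkeJacobian_F_subset (x : EuclideanSpace ℝ (Fin m)) :
    clarkeJacobian (F hA i) x ⊆ convexHull ℝ {J | ∃ u : (k : Fin m) → EuclideanSpace ℂ (Fin (n k)),
      IsUnitEigenvectors hA i x u ∧ J = formMatrix A u} := by
  refine convexHull_min ?_ (convex_convexHull ℝ _)
  rintro J ⟨y, hdiff, hy, hJ⟩
  have hmem := mem_convexHull_pi (s := Set.univ) (x := (J : Fin m → Fin m → ℝ))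
    fun k _ => row_mem_convexHull hA i hdiff hy hJ k
  refine convexHull_mono (fun J' hJ' => ?_) hmem
  choose u hu hrow using fun k => hJ' k trivial
  refine ⟨u, (isUnitEigenvectors_iff hA i x u).2 hu, ?_⟩
  ext k l
  rw [formMatrix_apply]
  exact (congrFun (hrow k) l).symm

end MEP

theorem mainTheorem5 {m : ℕ} {n : Fin m → ℕ}
    (A : (k : Fin m) → Fin (m + 1) → Matrix (Fin (n k)) (Fin (n k)) ℂ)
    (hA : ∀ k l, (A k l).IsHermitian) (i : (k : Fin m) → Fin (n k)) :
    -- `F_𝐢` is Lipschitz, so that its generalized Jacobian is defined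
    (∃ K : NNReal, LipschitzWith K (MEP.F hA i)) ∧
    -- differentiability and the Jacobian where the multiplicities are locally constant
    (∀ x : EuclideanSpace ℝ (Fin m),
      (∀ k, ∀ᶠ y in 𝓝 x, MEP.multiplicity hA k (i k) y = MEP.multiplicity hA k (i k) x) →
      DifferentiableAt ℝ (MEP.F hA i) x ∧
      ∀ u : (k : Fin m) → EuclideanSpace ℂ (Fin (n k)), MEP.IsUnitEigenvectors hA i x u →
        jacobianMatrix (MEP.F hA i) x = MEP.formMatrix A u) ∧
    -- the generalized Jacobian at an arbitrary point
    (∀ x : EuclideanSpace ℝ (Fin m),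
      clarkeJacobian (MEP.F hA i) x ⊆
        convexHull ℝ {J | ∃ u : (k : Fin m) → EuclideanSpace ℂ (Fin (n k)),
          MEP.IsUnitEigenvectors hA i x u ∧ J = MEP.formMatrix A u}) :=
  ⟨MEP.exists_lipschitzWith_F hA i,
    fun _ hmult => ⟨MEP.differentiableAt_F hA i hmult,
      fun _ => MEP.jacobianMatrix_F_eq_formMatrix hA i hmult⟩,
    MEP.clarkeJacobian_F_subset hA i⟩
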